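/- Let $P$ denote the HOMFLYPT polynomial: the unique invariant of oriented links with values in $\mathbb{Z}[v^{\pm1},z^{\pm1}]$ that equals $1$ on the trivial knot and satisfies the skein relation $$P_{D_+}(v,z)=vz\,P_{D_0}(v,z)+v^{2}\,P_{D_-}(v,z)$$ for oriented link diagrams $D_+$, $D_0$, $D_-$ that agree except near one crossing, which is positive, smoothed and negative respectively. The Conway, Jones and Alexander polynomials of a link $L$ are $$\nabla_L(z)=P_L(1,z),\qquad V_L(t)=P_L\bigl(t,(t-1)/\sqrt t\bigr),\qquad \Delta_L(t)=P_L\bigl(1,(t-1)/\sqrt t\bigr).$$ The writhe of a braid word $\prod_k\sigma_{i_k}^{\epsilon_k}$ with all $\epsilon_k=\pm1$ is $\sum_k\epsilon_k$, where $\sigma_i$ is a positive crossing, and $\widehat\beta$ denotes the standard closure of $\beta$. Let $\beta$ and $\gamma$ be words in the generators $\sigma_1,\sigma_2$ and their inverses of the braid group $B_3$ on three strands, with the same writhe. If $\nabla_{\widehat\beta}=\nabla_{\widehat\gamma}$, or $V_{\widehat\beta}=V_{\widehat\gamma}$, or $\Delta_{\widehat\beta}=\Delta_{\widehat\gamma}$,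 then $P_{\widehat\beta}=P_{\widehat\gamma}$. -/

import Mathlib

/-! ## Braid groups

`ArtinGroup m` is Artin's braid group on `m + 1` strands, with generators `σ 0, …, σ (m - 1)`. -/

/-- The relators of Artin's presentation: `σ i σ (i+1) σ i = σ (i+1) σ i σ (i+1)`, and
`σ i σ j = σ j σ i` if `i` and `j` differ by at least two. -/
inductive ArtinRel (m : ℕ) : FreeGroup (Fin m) → Prop
  | braid (i j : Fin m) (h : (i : ℕ) + 1 = j) :
      ArtinRel m (.of i * .of j * .of i * (.of j * .of i * .of j)⁻¹)
  | comm (i j : Fin m) (h : (i : ℕ) + 1 < j) :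
      ArtinRel m (.of i * .of j * (.of j * .of i)⁻¹)

/-- The braid group on `m + 1` strands. -/
def ArtinGroup (m : ℕ) : Type := PresentedGroup {r | ArtinRel m r}

namespace ArtinGroup

instance (m : ℕ) : Group (ArtinGroup m) :=
  inferInstanceAs (Group (PresentedGroup {r | ArtinRel m r}))

/-- The standard generator. As a crossing of a braid diagram it is positive. -/
def σ {m : ℕ} (i : Fin m) : ArtinGroup m := PresentedGroup.of i

/-- The universal property of the presentation. -/
def lift {m : ℕ} {G : Type*} [Group G] (f : Fin m → G)
    (hb : ∀ i j : Fin m, (i : ℕ) + 1 = j → f i * f j * f i = f j * f i * f j)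
    (hc : ∀ i j : Fin m, (i : ℕ) + 1 < j → f i * f j = f j * f i) : ArtinGroup m →* G :=
  PresentedGroup.toGroup (f := f) (rels := {r | ArtinRel m r}) (by
    rintro r (⟨i, j, h⟩ | ⟨i, j, h⟩)
    · simp only [map_mul, map_inv, FreeGroup.lift_apply_of, mul_inv_eq_one]; exact hb i j h
    · simp only [map_mul, map_inv, FreeGroup.lift_apply_of, mul_inv_eq_one]; exact hc i j h)

theorem lift_σ {m : ℕ} {G : Type*} [Group G] (f : Fin m → G) (hb) (hc) (i : Fin m) :
    lift f hb hc (σ i) = f i := PresentedGroup.toGroup.of _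

theorem braid {m : ℕ} (i j : Fin m) (h : (i : ℕ) + 1 = j) :
    σ i * σ j * σ i = σ j * σ i * σ j := by
  have := PresentedGroup.mk_eq_one_iff.2
    (Subgroup.subset_normalClosure (show _ ∈ {r | ArtinRel m r} from ArtinRel.braid i j h))
  simp only [map_mul, map_inv, mul_inv_eq_one] at this
  exact this

theorem comm {m : ℕ} (i j : Fin m) (h : (i : ℕ) + 1 < j) :
    σ i * σ j = σ j * σ i := by
  have := PresentedGroup.mk_eq_one_iff.2
    (Subgroup.subset_normalClosure (show _ ∈ {r | ArtinRel m r} from ArtinRel.comm i j h))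
  simp only [map_mul, map_inv, mul_inv_eq_one] at this
  exact this

@[elab_as_elim]
theorem induction {m : ℕ} {p : ArtinGroup m → Prop} (one : p 1)
    (mul : ∀ x i, p x → p (x * σ i)) (inv : ∀ x i, p x → p (x * (σ i)⁻¹)) (x) : p x := by
  have hx : x ∈ Subgroup.closure (Set.range (σ (m := m))) := by
    have := PresentedGroup.closure_range_of {r | ArtinRel m r}
    exact (SetLike.ext_iff.1 this x).2 (Subgroup.mem_top _)
  induction hx using Subgroup.closure_induction_right with
  | one => exact one
  | mul_right x _ y hy ih => obtain ⟨i, rfl⟩ := hy; exact mul x i ih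
  | mul_inv_cancel x _ y hy ih => obtain ⟨i, rfl⟩ := hy; exact inv x i ih

/-- The inclusion of braid groups that adds one strand on the right. -/
def ι {m : ℕ} : ArtinGroup m →* ArtinGroup (m + 1) :=
  lift (fun i => σ i.castSucc) (fun _ _ h => braid _ _ h) (fun _ _ h => comm _ _ h)

theorem ι_σ {m : ℕ} (i : Fin m) : ι (σ i) = σ i.castSucc := lift_σ ..

/-- The exponent sum. -/
def expSum {m : ℕ} : ArtinGroup m →* Multiplicative ℤ :=
  lift (fun _ => .ofAdd 1) (fun _ _ _ => rfl) (fun _ _ _ => rfl)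

end ArtinGroup

/-! ## Oriented links

By the theorems of Alexander and Markov, oriented links up to isotopy are the same as braids, on
any number of strands, up to conjugation and stabilisation. -/

open ArtinGroup in
/-- The two Markov moves on braids, the second with either sign; `⟨m, β⟩` is a braid on `m + 1`
strands. -/
inductive MarkovMove : (Σ m, ArtinGroup m) → (Σ m, ArtinGroup m) → Prop
  | conj {m : ℕ} (α β : ArtinGroup m) : MarkovMove ⟨m, α * β⟩ ⟨m, β * α⟩
  | stabPos {m : ℕ} (β : ArtinGroup m) : MarkovMove ⟨m, β⟩ ⟨m + 1, ι β * σ (Fin.last m)⟩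
  | stabNeg {m : ℕ} (β : ArtinGroup m) : MarkovMove ⟨m, β⟩ ⟨m + 1, ι β * (σ (Fin.last m))⁻¹⟩

/-- Oriented link types, as Markov classes of braids. -/
def OrientedLink : Type := Quot MarkovMove

/-- The link that is the standard closure of a braid. -/
def ArtinGroup.closure {m : ℕ} (β : ArtinGroup m) : OrientedLink := Quot.mk _ ⟨m, β⟩

theorem ArtinGroup.closure_conj {m : ℕ} (α β : ArtinGroup m) :
    (α * β).closure = (β * α).closure := Quot.sound (.conj α β)

theorem ArtinGroup.closure_stabPos {m : ℕ} (β : ArtinGroup m) :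
    (ι β * σ (Fin.last m)).closure = β.closure := (Quot.sound (.stabPos β)).symm

theorem ArtinGroup.closure_stabNeg {m : ℕ} (β : ArtinGroup m) :
    (ι β * (σ (Fin.last m))⁻¹).closure = β.closure := (Quot.sound (.stabNeg β)).symm

/-! ## The skein relation -/

noncomputable section

/-- The ring `ℤ[v, v⁻¹, z, z⁻¹]`, as Laurent polynomials in `v` with coefficients in
`ℤ[z, z⁻¹]`. -/
abbrev LaurentVZ : Type := LaurentPolynomial (LaurentPolynomial ℤ)

/-- The Laurent variable, as a unit. -/
def tUnit (R : Type) [CommRing R] : (LaurentPolynomial R)ˣ where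
  val := .T 1
  inv := .T (-1)
  val_inv := by rw [← LaurentPolynomial.T_add, add_neg_cancel, LaurentPolynomial.T_zero]
  inv_val := by rw [← LaurentPolynomial.T_add, neg_add_cancel, LaurentPolynomial.T_zero]

namespace LaurentVZ
open LaurentPolynomial

/-- The variable `v`. -/
def v : LaurentVZ := T 1

/-- The variable `z`. -/
def z : LaurentVZ := C (T 1)

end LaurentVZ

end

open LaurentVZ ArtinGroup in
/-- `P` is an invariant of oriented links with value `1` on the trivial knot (the closure of the
braid on one strand) that satisfies the skein relation `P(D₊) = v z P(D₀) + v² P(D₋)`. The three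
diagrams are closed braids that differ in one crossing, which is `σ i`, absent, or `(σ i)⁻¹`. -/
structure IsHomflypt (P : OrientedLink → LaurentVZ) : Prop where
  unknot : P (1 : ArtinGroup 0).closure = 1
  skein : ∀ (m : ℕ) (α β : ArtinGroup m) (i : Fin m),
    P (α * σ i * β).closure = v * z * P (α * β).closure + v ^ 2 * P (α * (σ i)⁻¹ * β).closure

/-! ## The Hecke algebras and the Ocneanu trace

They serve only to show that the HOMFLYPT polynomial exists and is unique. -/

section Hecke
variable {K : Type} [CommRing K]

/-- The relation `σ i = (σ i)⁻¹ + z` on the group algebra. -/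
inductive SkeinRel (z : K) (m : ℕ) : MonoidAlgebra K (ArtinGroup m) →
    MonoidAlgebra K (ArtinGroup m) → Prop
  | mk (i : Fin m) : SkeinRel z m (MonoidAlgebra.of K _ (ArtinGroup.σ i))
      (MonoidAlgebra.of K _ (ArtinGroup.σ i)⁻¹ + algebraMap K _ z)

/-- The Hecke algebra: the group algebra of the braid group on `m + 1` strands modulo
`σ i = (σ i)⁻¹ + z`. -/
def Hecke (z : K) (m : ℕ) : Type := RingQuot (SkeinRel z m)

namespace Hecke
open ArtinGroup
variable {z : K} {m : ℕ}

noncomputable instance : Ring (Hecke z m) := inferInstanceAs (Ring (RingQuot (SkeinRel z m)))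
noncomputable instance : Algebra K (Hecke z m) :=
  inferInstanceAs (Algebra K (RingQuot (SkeinRel z m)))

/-- The quotient map from the group algebra. -/
noncomputable def mk : MonoidAlgebra K (ArtinGroup m) →ₐ[K] Hecke z m :=
  RingQuot.mkAlgHom K (SkeinRel z m)

variable (z) in
/-- The class of a braid. -/
noncomputable def π : ArtinGroup m →* Hecke z m :=
  (mk : MonoidAlgebra K (ArtinGroup m) →ₐ[K] Hecke z m).toMonoidHom.comp (MonoidAlgebra.of K _)

variable (z) in
/-- The class of a generator. -/
noncomputable def g (i : Fin m) : Hecke z m := π z (σ i)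

theorem π_inv (i : Fin m) : π z (σ i)⁻¹ = g z i - algebraMap K _ z := by
  have := RingQuot.mkAlgHom_rel K (SkeinRel.mk (z := z) i)
  rw [map_add, AlgHom.commutes] at this
  exact eq_sub_of_add_eq this.symm

theorem g_sq (i : Fin m) : g z i * g z i = z • g z i + 1 := by
  have h : g z i * π z (σ i)⁻¹ = 1 := by rw [g, ← map_mul]; simp
  rw [π_inv, mul_sub, sub_eq_iff_eq_add] at h
  rw [h, ← Algebra.commutes, Algebra.smul_def, add_comm]

theorem g_braid (i j : Fin m) (h : (i : ℕ) + 1 = j) :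
    g z i * g z j * g z i = g z j * g z i * g z j := by
  simp only [g, ← map_mul, braid i j h]

theorem g_comm (i j : Fin m) (h : (i : ℕ) + 1 < j) : g z i * g z j = g z j * g z i := by
  simp only [g, ← map_mul, comm i j h]

theorem mk_surjective : Function.Surjective (mk : _ → Hecke z m) :=
  RingQuot.mkAlgHom_surjective K _

theorem span_π : Submodule.span K (Set.range (π (m := m) z)) = ⊤ := by
  rw [eq_top_iff]
  rintro x -
  obtain ⟨x, rfl⟩ := mk_surjective x
  induction x using MonoidAlgebra.induction_on with
  | of a => exact Submodule.subset_span ⟨a, rfl⟩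
  | add x y hx hy => rw [map_add]; exact add_mem hx hy
  | smul r x hx => rw [map_smul]; exact Submodule.smul_mem _ _ hx

@[elab_as_elim]
theorem induction {p : Hecke z m → Prop} (one : p 1)
    (add : ∀ x y, p x → p y → p (x + y)) (smul : ∀ (c : K) x, p x → p (c • x))
    (mul : ∀ x i, p x → p (x * g z i)) (x) : p x := by
  have hx : x ∈ Submodule.span K (Set.range (π (m := m) z)) := by rw [span_π]; trivial
  induction hx using Submodule.span_induction with
  | mem x h =>
    obtain ⟨b, rfl⟩ := h
    induction b using ArtinGroup.induction with
    | one => simpa using one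
    | mul x i h => rw [map_mul]; exact mul _ _ h
    | inv x i h =>
      rw [map_mul, π_inv, mul_sub, ← Algebra.commutes, ← Algebra.smul_def, sub_eq_add_neg,
        ← neg_smul]
      exact add _ _ (mul _ _ h) (smul _ _ h)
  | zero => simpa using smul 0 1 one
  | add x y _ _ hx hy => exact add x y hx hy
  | smul c x _ hx => exact smul c x hx

section lift
variable {A : Type*} [Ring A] [Algebra K A] (f : Fin m → A)
    (hq : ∀ i, f i * f i = z • f i + 1)
    (hb : ∀ i j : Fin m, (i : ℕ) + 1 = j → f i * f j * f i = f j * f i * f j)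
    (hc : ∀ i j : Fin m, (i : ℕ) + 1 < j → f i * f j = f j * f i)

/-- The universal property of the Hecke algebra. -/
noncomputable def lift : Hecke z m →ₐ[K] A :=
  let u : Fin m → Aˣ := fun i => ⟨f i, f i - algebraMap K A z,
    by rw [mul_sub, hq, ← Algebra.commutes, ← Algebra.smul_def]; abel,
    by rw [sub_mul, hq, ← Algebra.smul_def]; abel⟩
  RingQuot.liftAlgHom K ⟨MonoidAlgebra.lift K A (ArtinGroup m) ((Units.coeHom A).comp
    (ArtinGroup.lift u (fun i j h => Units.ext (hb i j h)) (fun i j h => Units.ext (hc i j h)))),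
    by
      rintro _ _ ⟨i⟩
      rw [map_add, MonoidAlgebra.lift_of, MonoidAlgebra.lift_of, AlgHom.commutes,
        MonoidHom.comp_apply, MonoidHom.comp_apply, map_inv, lift_σ]
      simp [u]⟩

theorem lift_g (i : Fin m) : lift f hq hb hc (g z i) = f i := by
  unfold lift
  refine (RingQuot.liftAlgHom_mkAlgHom_apply K _ _ _).trans ?_
  rw [MonoidAlgebra.lift_of, MonoidHom.comp_apply, lift_σ]
  rfl
end lift

/-- The inclusion of Hecke algebras that adds one strand. -/
noncomputable def ι : Hecke z m →ₐ[K] Hecke z (m + 1) :=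
  lift (fun i => g z i.castSucc) (fun _ => g_sq _) (fun _ _ h => g_braid _ _ h)
    (fun _ _ h => g_comm _ _ h)

theorem ι_g (i : Fin m) : ι (g z i) = g z i.castSucc := lift_g ..

variable (z m) in
/-- The generators, indexed by natural numbers. -/
noncomputable def gn (i : ℕ) : Hecke z m := if h : i < m then g z ⟨i, h⟩ else 1

theorem gn_of_lt {i : ℕ} (h : i < m) : gn z m i = g z ⟨i, h⟩ := dif_pos h

theorem gn_sq {i : ℕ} (h : i < m) : gn z m i * gn z m i = z • gn z m i + 1 := by
  rw [gn_of_lt h, g_sq]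

theorem gn_braid {i : ℕ} (h : i + 1 < m) :
    gn z m i * (gn z m (i + 1) * gn z m i) = gn z m (i + 1) * (gn z m i * gn z m (i + 1)) := by
  rw [gn_of_lt h, gn_of_lt (Nat.lt_of_succ_lt h), ← mul_assoc, ← mul_assoc, g_braid _ _ rfl]

theorem gn_comm {i j : ℕ} (h : i + 1 < j) (hj : j < m) :
    gn z m i * gn z m j = gn z m j * gn z m i := by
  rw [gn_of_lt hj, gn_of_lt (show i < m by omega), g_comm _ _ h]

variable (z m) in
/-- Right multiplication by `g i` on `H_{m+1}`, written in coordinates: the function `f` stands for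
`∑ s, f s * (g m * g (m - 1) * ⋯ * g s)`, where the product is empty for `s = m + 1`. -/
noncomputable def ρ (i : Fin (m + 1)) :
    Module.End (Hecke z m) (Fin (m + 2) → Hecke z m) where
  toFun f s :=
    if (s : ℕ) < i then f s * gn z m (i - 1)
    else if (s : ℕ) = i then f i.succ + z • f i.castSucc
    else if (s : ℕ) = i + 1 then f i.castSucc
    else f s * gn z m i
  map_add' f h := by
    ext s
    simp only [Pi.add_apply]
    split_ifs <;> simp only [add_mul, smul_add]
    abel
  map_smul' a f := by
    ext s
    simp only [Pi.smul_apply, RingHom.id_apply, smul_eq_mul]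
    split_ifs <;> simp only [mul_assoc, mul_add, mul_smul_comm]

section
variable {i k : ℕ} (f : Fin (m + 2) → Hecke z m)

theorem ρ_lt (hi : i < m + 1) (hk : k < m + 2) (h : k < i) :
    ρ z m ⟨i, hi⟩ f ⟨k, hk⟩ = f ⟨k, hk⟩ * gn z m (i - 1) := by
  simp [ρ, h]

theorem ρ_eq (hi : i < m + 1) (hk : i < m + 2) :
    ρ z m ⟨i, hi⟩ f ⟨i, hk⟩ = f ⟨i + 1, by omega⟩ + z • f ⟨i, hk⟩ := by
  simp [ρ]

theorem ρ_succ (hi : i < m + 1) (hk : i + 1 < m + 2) :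
    ρ z m ⟨i, hi⟩ f ⟨i + 1, hk⟩ = f ⟨i, by omega⟩ := by
  simp [ρ]

theorem ρ_gt (hi : i < m + 1) (hk : k < m + 2) (h : i + 1 < k) :
    ρ z m ⟨i, hi⟩ f ⟨k, hk⟩ = f ⟨k, hk⟩ * gn z m i := by
  simp [ρ, show ¬ k < i by omega, show k ≠ i by omega, show k ≠ i + 1 by omega]
end

theorem ρ_sq (i : Fin (m + 1)) : ρ z m i * ρ z m i = z • ρ z m i + 1 := by
  obtain ⟨i, hi⟩ := i
  refine LinearMap.ext fun f => funext fun ⟨k, hk⟩ => ?_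
  simp only [Module.End.mul_apply, LinearMap.add_apply, LinearMap.smul_apply, Pi.add_apply,
    Pi.smul_apply, Module.End.one_apply]
  rcases lt_trichotomy k i with h | rfl | h
  · simp only [ρ_lt _ hi hk h, mul_assoc, gn_sq (show i - 1 < m by omega), mul_add, mul_one,
      mul_smul_comm]
  · simp only [ρ_eq, ρ_succ]
    abel
  · obtain rfl | h : k = i + 1 ∨ i + 1 < k := by omega
    · simp only [ρ_eq, ρ_succ]
      abel
    · simp only [ρ_gt _ hi hk h, mul_assoc, gn_sq (show i < m by omega), mul_add, mul_one,
        mul_smul_comm]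

theorem ρ_braid (i j : Fin (m + 1)) (h : (i : ℕ) + 1 = j) :
    ρ z m i * ρ z m j * ρ z m i = ρ z m j * ρ z m i * ρ z m j := by
  obtain ⟨i, hi⟩ := i
  obtain ⟨j, hj⟩ := j
  obtain rfl : i + 1 = j := h
  refine LinearMap.ext fun f => funext fun ⟨k, hk⟩ => ?_
  simp only [Module.End.mul_apply]
  obtain h | rfl | rfl | rfl | h : k < i ∨ k = i ∨ k = i + 1 ∨ k = i + 1 + 1 ∨ i + 1 + 1 < k := by
    omega
  · obtain ⟨i, rfl⟩ : ∃ a, i = a + 1 := ⟨i - 1, by omega⟩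
    simp only [ρ_lt _ hi hk h, ρ_lt _ hj hk (show k < i + 1 + 1 by omega), mul_assoc,
      Nat.add_sub_cancel, gn_braid (show i + 1 < m by omega)]
  · simp only [ρ_eq, ρ_succ, ρ_lt _ hj hk (show k < k + 1 by omega), Nat.add_sub_cancel,
      ρ_gt _ hi (show k + 1 + 1 < m + 2 by omega) (show k + 1 < k + 1 + 1 by omega), add_mul, smul_mul_assoc,
      mul_assoc, gn_sq (show k < m by omega), mul_add, mul_smul_comm, mul_one, smul_add]
    abel
  · simp only [ρ_eq, ρ_succ, ρ_lt _ hj (show i < m + 2 by omega) (show i < i + 1 by omega),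
      Nat.add_sub_cancel,
      ρ_gt _ hi (show i + 1 + 1 < m + 2 by omega) (show i + 1 < i + 1 + 1 by omega), add_mul, smul_mul_assoc]
  · simp only [ρ_eq, ρ_succ, ρ_lt _ hj (show i < m + 2 by omega) (show i < i + 1 by omega),
      Nat.add_sub_cancel,
      ρ_gt _ hi (show i + 1 + 1 < m + 2 by omega) (show i + 1 < i + 1 + 1 by omega), add_mul, smul_mul_assoc]
  · simp only [ρ_gt _ hi hk (show i + 1 < k by omega), ρ_gt _ hj hk h, mul_assoc,
      gn_braid (show i + 1 < m by omega)]

theorem ρ_comm (i j : Fin (m + 1)) (h : (i : ℕ) + 1 < j) :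
    ρ z m i * ρ z m j = ρ z m j * ρ z m i := by
  obtain ⟨i, hi⟩ := i
  obtain ⟨j, hj⟩ := j
  obtain ⟨d, rfl⟩ : ∃ d, j = i + 1 + 1 + d := ⟨j - (i + 1 + 1), by simp at h; omega⟩
  clear h
  refine LinearMap.ext fun f => funext fun ⟨k, hk⟩ => ?_
  simp only [Module.End.mul_apply]
  obtain h | rfl | rfl | h | rfl | rfl | h : k < i ∨ k = i ∨ k = i + 1 ∨
      (i + 1 < k ∧ k < i + 1 + 1 + d) ∨ k = i + 1 + 1 + d ∨ k = i + 1 + 1 + d + 1 ∨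
      i + 1 + 1 + d + 1 < k := by omega
  · simp only [ρ_lt _ hi hk h, ρ_lt _ hj hk (show k < i + 1 + 1 + d by omega), mul_assoc]
    obtain ⟨i, rfl⟩ : ∃ a, i = a + 1 := ⟨i - 1, by omega⟩
    rw [gn_comm (z := z) (m := m) (i := i + 1 - 1) (j := i + 1 + 1 + 1 + d - 1)
      (by omega) (by omega)]
  · simp only [ρ_eq, ρ_succ, ρ_lt _ hj hk (show k < k + 1 + 1 + d by omega), add_mul,
      ρ_lt _ hj (show k + 1 < m + 2 by omega) (show k + 1 < k + 1 + 1 + d by omega),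
      smul_mul_assoc]
  · simp only [ρ_eq, ρ_succ, ρ_lt _ hj hk (show i + 1 < i + 1 + 1 + d by omega), add_mul,
      ρ_lt _ hj (show i < m + 2 by omega) (show i < i + 1 + 1 + d by omega),
      smul_mul_assoc]
  · simp only [ρ_gt _ hi hk h.1, ρ_lt _ hj hk h.2, mul_assoc]
    rw [gn_comm (z := z) (m := m) (i := i) (j := i + 1 + 1 + d - 1) (by omega) (by omega)]
  · simp only [ρ_eq, ρ_succ, add_mul, smul_mul_assoc,
      ρ_gt _ hi hk (show i + 1 < i + 1 + 1 + d by omega),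
      ρ_gt _ hi (show i + 1 + 1 + d + 1 < m + 2 by omega) (show i + 1 < i + 1 + 1 + d + 1 by omega)]
  · simp only [ρ_eq, ρ_succ, add_mul, smul_mul_assoc,
      ρ_gt _ hi (show i + 1 + 1 + d < m + 2 by omega) (show i + 1 < i + 1 + 1 + d by omega),
      ρ_gt _ hi (show i + 1 + 1 + d + 1 < m + 2 by omega) (show i + 1 < i + 1 + 1 + d + 1 by omega)]
  · simp only [ρ_gt _ hi hk (show i + 1 < k by omega), ρ_gt _ hj hk h, mul_assoc]
    rw [gn_comm (z := z) (m := m) (i := i) (j := i + 1 + 1 + d) (by omega) (by omega)]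

variable (z m) in
/-- The right action of `H_{m+1}` by the operators `ρ`. -/
noncomputable def act : Hecke z (m + 1) →ₐ[K] (Module.End (Hecke z m) (Fin (m + 2) → Hecke z m))ᵐᵒᵖ :=
  lift (fun i => .op (ρ z m i))
    (fun i => by rw [← MulOpposite.op_mul, ρ_sq]; rfl)
    (fun i j h => by simp only [← MulOpposite.op_mul, ← mul_assoc, ρ_braid i j h])
    (fun i j h => by simp only [← MulOpposite.op_mul, ρ_comm i j h])

variable (z m) in
/-- The coordinates of an element of `H_{m+1}` over `H_m`. -/
noncomputable def φ : Hecke z (m + 1) →ₗ[K] (Fin (m + 2) → Hecke z m) where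
  toFun x := (act z m x).unop (Pi.single (Fin.last _) 1)
  map_add' x y := by simp
  map_smul' c x := by simp

theorem φ_one : φ z m 1 = Pi.single (Fin.last _) 1 := by simp [φ]

theorem φ_mul_g (x : Hecke z (m + 1)) (i : Fin (m + 1)) :
    φ z m (x * g z i) = ρ z m i (φ z m x) := by
  simp [φ, act, lift_g]

theorem act_ι (a : Hecke z m) : (act z m (ι a)).unop (Pi.single (Fin.last _) 1) =
    a • Pi.single (Fin.last _) 1 := by
  induction a using induction with
  | one => simp
  | add x y hx hy => simp only [map_add, MulOpposite.unop_add, LinearMap.add_apply, hx, hy, add_smul]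
  | smul c x hx =>
    simp only [map_smul, MulOpposite.unop_smul, LinearMap.smul_apply, hx, smul_assoc]
  | mul x i hx =>
    rw [map_mul, map_mul, MulOpposite.unop_mul, Module.End.mul_apply, hx, map_smul, mul_smul]
    congr 1
    rw [ι_g, act, lift_g]
    obtain ⟨i, hi⟩ := i
    ext1 ⟨k, hk⟩
    show ρ z m ⟨i, _⟩ _ _ = _
    rw [← gn_of_lt hi]
    obtain h | rfl | rfl | h : k < i ∨ k = i ∨ k = i + 1 ∨ i + 1 < k := by omega
    · rw [ρ_lt _ _ _ h]
      simp [Fin.ext_iff, show k ≠ m + 1 by omega]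
    · rw [ρ_eq]
      simp [Fin.ext_iff, show k ≠ m + 1 by omega, show k ≠ m by omega]
    · rw [ρ_succ]
      simp [Fin.ext_iff, show i ≠ m + 1 by omega, show i ≠ m by omega]
    · rw [ρ_gt _ _ _ h]
      simp [Pi.single_apply]

theorem φ_ι_mul (a : Hecke z m) (x : Hecke z (m + 1)) : φ z m (ι a * x) = a • φ z m x := by
  show (act z m (ι a * x)).unop _ = a • (act z m x).unop _
  rw [map_mul, MulOpposite.unop_mul, Module.End.mul_apply, act_ι, map_smul]

variable (z m) in
/-- The product `g (m - 1) * g (m - 2) * ⋯ * g s`. -/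
noncomputable def D (s : ℕ) : Hecke z m :=
  ((List.range (m - s)).map fun k => gn z m (m - 1 - k)).prod

theorem D_self : D z m m = 1 := by simp [D]

theorem D_step {s : ℕ} (h : s < m) : D z m s = D z m (s + 1) * gn z m s := by
  rw [D, D, show m - s = m - (s + 1) + 1 by omega, List.range_succ, List.map_append,
    List.prod_append]
  simp [show m - 1 - (m - (s + 1)) = s by omega]

theorem D_comm {s i : ℕ} (h : i + 1 < s) (hs : s ≤ m) :
    D z m s * gn z m i = gn z m i * D z m s := by
  revert h
  induction hs using Nat.decreasingInduction with
  | self => intro _; rw [D_self, one_mul, mul_one]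
  | of_succ s hs ih =>
    intro h
    rw [D_step hs, mul_assoc, ← gn_comm h hs, ← mul_assoc, ih (by omega), mul_assoc]

theorem D_low {s i : ℕ} (h : s < i) (hi : i < m) :
    D z m s * gn z m i = gn z m (i - 1) * D z m s := by
  obtain ⟨j, rfl⟩ : ∃ j, i = j + 1 := ⟨i - 1, by omega⟩
  have hs : s ≤ j := by omega
  clear h
  induction hs using Nat.decreasingInduction with
  | self =>
    rw [D_step (show j < m by omega), D_step hi, Nat.add_sub_cancel, mul_assoc, mul_assoc,
      ← gn_braid hi, ← mul_assoc, D_comm (by omega) (by omega), mul_assoc, mul_assoc]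
  | of_succ s hs ih =>
    rw [D_step (show s < m by omega), mul_assoc, gn_comm (by omega) hi, ← mul_assoc, ih, mul_assoc]

variable (v : Kˣ) (δ : K)

variable (z m) in
/-- The value of the conditional expectation on the `s`-th basis element. -/
noncomputable def W (s : Fin (m + 2)) : Hecke z m :=
  if (s : ℕ) = m + 1 then algebraMap K _ δ else (↑v⁻¹ : K) • D z m s

variable (z m) in
/-- The conditional expectation `H_{m+1} → H_m`: it sends `a` to `δ a` and `a * g m * b` to
`v⁻¹ a b`, for `a` and `b` in `H_m`. -/
noncomputable def E : Hecke z (m + 1) →ₗ[K] Hecke z m where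
  toFun x := ∑ s, φ z m x s * W z m v δ s
  map_add' x y := by simp [add_mul, Finset.sum_add_distrib]
  map_smul' c x := by simp [Finset.smul_sum]

theorem E_ι_mul (a : Hecke z m) (x : Hecke z (m + 1)) :
    E z m v δ (ι a * x) = a * E z m v δ x := by
  simp [E, φ_ι_mul, Finset.mul_sum, mul_assoc]

theorem E_one : E z m v δ 1 = algebraMap K _ δ := by
  simp only [E, LinearMap.coe_mk, AddHom.coe_mk, φ_one]
  rw [Finset.sum_eq_single (Fin.last _)]
  · simp [W]
  · intro s _ hs; simp [hs]
  · simp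

theorem E_mul_g (x : Hecke z (m + 1)) (i : Fin m) :
    E z m v δ (x * g z i.castSucc) = E z m v δ x * g z i := by
  simp only [E, LinearMap.coe_mk, AddHom.coe_mk, φ_mul_g, Finset.sum_mul]
  obtain ⟨i, hi⟩ := i
  rw [← gn_of_lt hi, ← sub_eq_zero, ← Finset.sum_sub_distrib]
  generalize φ z m x = f
  have hi1 : i < m + 2 := by omega
  have hi2 : i + 1 < m + 2 := by omega
  rw [Fintype.sum_eq_add ⟨i, hi1⟩ ⟨i + 1, hi2⟩ (by simp)]
  · simp only [Fin.castSucc_mk, ρ_eq, ρ_succ, W, show i ≠ m + 1 by omega, show i ≠ m by omega,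
      Nat.add_right_cancel_iff, if_false, D_step hi, mul_assoc, smul_mul_assoc, gn_sq hi,
      mul_smul_comm, mul_add, add_mul, mul_one, smul_add]
    abel
  · rintro ⟨k, hk⟩ ⟨h1, h2⟩
    simp only [ne_eq, Fin.mk.injEq] at h1 h2
    rw [sub_eq_zero, mul_assoc]
    obtain h | h : k < i ∨ i + 1 < k := by omega
    · rw [Fin.castSucc_mk, ρ_lt _ _ _ h, mul_assoc]
      simp only [W, show k ≠ m + 1 by omega, if_false]
      rw [mul_smul_comm, smul_mul_assoc, D_low h hi]
    · rw [Fin.castSucc_mk, ρ_gt _ _ _ h, mul_assoc]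
      congr 1
      simp only [W]
      split_ifs with h'
      · rw [Algebra.commutes]
      · rw [mul_smul_comm, smul_mul_assoc, D_comm h (by omega)]

theorem E_mul_ι (x : Hecke z (m + 1)) (b : Hecke z m) :
    E z m v δ (x * ι b) = E z m v δ x * b := by
  induction b using induction generalizing x with
  | one => simp
  | add b c hb hc => simp only [map_add, mul_add, hb, hc]
  | smul c b hb => simp only [map_smul, mul_smul_comm, hb]
  | mul b i hb => rw [map_mul (ι (z := z)), ι_g, ← mul_assoc, E_mul_g, hb, mul_assoc]

theorem E_ι (a : Hecke z m) : E z m v δ (ι a) = δ • a := by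
  rw [← mul_one (ι a), E_ι_mul, E_one, ← Algebra.commutes, Algebra.smul_def]

variable (z m) in
/-- The last generator. -/
noncomputable abbrev gl : Hecke z (m + 1) := g z (Fin.last m)

theorem E_gl : E z m v δ (gl z m) = algebraMap K _ (↑v⁻¹ : K) := by
  rw [← one_mul (gl z m)]
  simp only [E, LinearMap.coe_mk, AddHom.coe_mk, φ_mul_g, φ_one]
  rw [Finset.sum_eq_single ⟨m, by omega⟩]
  · rw [show Fin.last m = ⟨m, by omega⟩ from rfl, ρ_eq]
    rw [show (⟨m + 1, by omega⟩ : Fin (m + 2)) = Fin.last _ from rfl]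
    simp [W, D_self, Fin.ext_iff, Algebra.smul_def]
  · rintro ⟨k, hk⟩ _ hs
    rw [show Fin.last m = ⟨m, by omega⟩ from rfl]
    obtain rfl | h : k = m + 1 ∨ k < m := by simp at hs; omega
    · rw [ρ_succ]; simp [Fin.ext_iff]
    · rw [ρ_lt _ _ _ h]; simp [Fin.ext_iff, show k ≠ m + 1 by omega]
  · simp

theorem E_sandwich (a b : Hecke z m) :
    E z m v δ (ι a * gl z m * ι b) = (↑v⁻¹ : K) • (a * b) := by
  rw [E_mul_ι, E_ι_mul, E_gl, ← Algebra.commutes, mul_assoc, Algebra.smul_def]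

theorem gl_comm (a : Hecke z m) : gl z (m + 1) * ι (ι a) = ι (ι a) * gl z (m + 1) := by
  induction a using induction with
  | one => simp
  | add b c hb hc => simp only [map_add, mul_add, add_mul, hb, hc]
  | smul c b hb => simp only [map_smul, mul_smul_comm, smul_mul_assoc, hb]
  | mul b i hb =>
    rw [map_mul, map_mul, ← mul_assoc, hb, mul_assoc, mul_assoc, ι_g, ι_g]
    congr 1
    exact (g_comm _ _ (by simp)).symm

theorem zero_scalar (x : Hecke z 0) : ∃ c : K, x = algebraMap K _ c := by
  induction x using induction with
  | one => exact ⟨1, by simp⟩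
  | add x y hx hy =>
    obtain ⟨⟨c, rfl⟩, ⟨d, rfl⟩⟩ := And.intro hx hy
    exact ⟨c + d, by simp⟩
  | smul c x hx =>
    obtain ⟨d, rfl⟩ := hx
    exact ⟨c * d, by simp [Algebra.smul_def]⟩
  | mul x i _ => exact i.elim0

variable (z) in
theorem span_sandwich (m : ℕ) : Submodule.span K
    (Set.range (ι (z := z) (m := m)) ∪
      Set.range fun p : Hecke z m × Hecke z m => ι p.1 * gl z m * ι p.2) = ⊤ := by
  set S : ∀ m, Submodule K (Hecke z (m + 1)) := fun m => Submodule.span K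
    (Set.range (ι (z := z) (m := m)) ∪
      Set.range fun p : Hecke z m × Hecke z m => ι p.1 * gl z m * ι p.2) with hS
  have h1 : ∀ m a, ι a ∈ S m := fun m a => Submodule.subset_span (Or.inl ⟨a, rfl⟩)
  have h2 : ∀ m a b, ι a * gl z m * ι b ∈ S m := fun m a b =>
    Submodule.subset_span (Or.inr ⟨(a, b), rfl⟩)
  have h3 : ∀ m a, ι a * gl z m ∈ S m := fun m a => by simpa using h2 m a 1
  suffices H : ∀ m, S m = ⊤ from H m
  intro m
  induction m with
  | zero =>
    rw [eq_top_iff]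
    rintro x -
    induction x using induction with
    | one => simpa using h1 0 1
    | add x y hx hy => exact add_mem hx hy
    | smul c x hx => exact Submodule.smul_mem _ _ hx
    | mul x i hx =>
      obtain rfl : i = Fin.last 0 := Fin.ext (show (i : ℕ) = 0 by omega)
      induction hx using Submodule.span_induction with
      | mem x hx =>
        rcases hx with ⟨a, rfl⟩ | ⟨⟨a, b⟩, rfl⟩
        · exact h3 0 a
        · obtain ⟨c, rfl⟩ := zero_scalar b
          dsimp only
          rw [AlgHom.commutes, ← Algebra.commutes, ← Algebra.smul_def, smul_mul_assoc, mul_assoc,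
            g_sq, mul_add, mul_one, mul_smul_comm, smul_add]
          exact add_mem (Submodule.smul_mem _ _ (Submodule.smul_mem _ _ (h3 0 a)))
            (Submodule.smul_mem _ _ (h1 0 a))
      | zero => simp
      | add x y _ _ hx hy => rw [add_mul]; exact add_mem hx hy
      | smul c x _ hx => rw [smul_mul_assoc]; exact Submodule.smul_mem _ _ hx
  | succ m ih =>
    rw [eq_top_iff]
    rintro x -
    induction x using induction with
    | one => simpa using h1 (m + 1) 1
    | add x y hx hy => exact add_mem hx hy
    | smul c x hx => exact Submodule.smul_mem _ _ hx
    | mul x i hx =>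
      induction hx using Submodule.span_induction with
      | mem x hx =>
        cases i using Fin.lastCases with
        | cast i =>
          rcases hx with ⟨a, rfl⟩ | ⟨⟨a, b⟩, rfl⟩
          · rw [← ι_g, ← map_mul]; exact h1 _ _
          · rw [← ι_g, mul_assoc, ← map_mul]; exact h2 _ _ _
        | last =>
          rcases hx with ⟨a, rfl⟩ | ⟨⟨a, b⟩, rfl⟩
          · exact h3 _ a
          · dsimp only
            have hb : b ∈ S m := by rw [ih]; trivial
            induction hb using Submodule.span_induction with
            | mem b hb =>
              rcases hb with ⟨c, rfl⟩ | ⟨⟨c, d⟩, rfl⟩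
              · rw [mul_assoc, ← gl_comm, ← mul_assoc, mul_assoc _ (gl z _) (gl z _), g_sq,
                  mul_add, add_mul, mul_one, mul_smul_comm, smul_mul_assoc, ← map_mul]
                exact add_mem (Submodule.smul_mem _ _ (h2 _ _ _)) (h1 _ _)
              · have key : gl z (m + 1) * ι (gl z m) * gl z (m + 1) =
                    ι (gl z m) * gl z (m + 1) * ι (gl z m) := by
                  rw [ι_g]; exact (g_braid _ _ (by simp)).symm
                have : ι a * gl z (m + 1) * ι (ι c * gl z m * ι d) * gl z (m + 1) =
                    ι (a * ι c * gl z m) * gl z (m + 1) * ι (gl z m * ι d) := by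
                  simp only [map_mul, mul_assoc]
                  rw [← gl_comm d, ← mul_assoc (gl z (m + 1)) (ι (ι c)), gl_comm c]
                  simp only [mul_assoc]
                  simp only [← mul_assoc _ _ (ι (ι d))]
                  rw [← mul_assoc (gl z (m + 1)), key]
                  simp only [mul_assoc]
                rw [this]
                exact h2 _ _ _
            | zero => simp
            | add x y _ _ hx hy => simpa only [map_add, mul_add, add_mul] using add_mem hx hy
            | smul c x _ hx =>
              simpa only [map_smul, mul_smul_comm, smul_mul_assoc] using Submodule.smul_mem _ _ hx
      | zero => simp
      | add x y _ _ hx hy => rw [add_mul]; exact add_mem hx hy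
      | smul c x _ hx => rw [smul_mul_assoc]; exact Submodule.smul_mem _ _ hx

/-- Linear maps on `H_{m+1}` agree if they agree on `H_m` and `H_m g_m H_m`. -/
theorem ext_sandwich {V : Type*} [AddCommGroup V] [Module K V] {A B : Hecke z (m + 1) →ₗ[K] V}
    (h1 : ∀ a, A (ι a) = B (ι a))
    (h2 : ∀ a b, A (ι a * gl z m * ι b) = B (ι a * gl z m * ι b)) : A = B := by
  refine LinearMap.ext_on (span_sandwich z m) ?_
  rintro x (⟨a, rfl⟩ | ⟨⟨a, b⟩, rfl⟩)
  · exact h1 a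
  · exact h2 a b

theorem E_conj (b : Hecke z (m + 1)) :
    E z (m + 1) v δ (gl z (m + 1) * ι b * gl z (m + 1)) =
      (z * ↑v⁻¹ : K) • b + ι (E z m v δ b) := by
  let A : Hecke z (m + 1) →ₗ[K] Hecke z (m + 1) := E z (m + 1) v δ ∘ₗ
    LinearMap.mulRight K (gl z (m + 1)) ∘ₗ LinearMap.mulLeft K (gl z (m + 1)) ∘ₗ
      ι.toLinearMap
  let B : Hecke z (m + 1) →ₗ[K] Hecke z (m + 1) :=
    (z * ↑v⁻¹ : K) • LinearMap.id + ι.toLinearMap ∘ₗ E z m v δ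
  have : A = B := by
    refine ext_sandwich (fun c => ?_) (fun c d => ?_)
    · simp only [A, B, LinearMap.comp_apply, LinearMap.mulRight_apply, LinearMap.mulLeft_apply,
        AlgHom.toLinearMap_apply, LinearMap.add_apply, LinearMap.smul_apply, LinearMap.id_apply]
      rw [gl_comm, mul_assoc, g_sq, E_ι_mul, map_add, map_smul, E_gl, E_one, E_ι, mul_add,
        ← Algebra.commutes, mul_smul_comm, ← Algebra.commutes, ← Algebra.smul_def,
        ← Algebra.smul_def, smul_smul, map_smul]
    · simp only [A, B, LinearMap.comp_apply, LinearMap.mulRight_apply, LinearMap.mulLeft_apply,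
        AlgHom.toLinearMap_apply, LinearMap.add_apply, LinearMap.smul_apply, LinearMap.id_apply]
      have key : gl z (m + 1) * ι (gl z m) * gl z (m + 1) =
          ι (gl z m) * gl z (m + 1) * ι (gl z m) := by
        rw [ι_g]; exact (g_braid _ _ (by simp)).symm
      have : gl z (m + 1) * ι (ι c * gl z m * ι d) * gl z (m + 1) =
          ι (ι c * gl z m) * gl z (m + 1) * ι (gl z m * ι d) := by
        simp only [map_mul, mul_assoc]
        rw [← gl_comm d, ← mul_assoc (gl z (m + 1)) (ι (ι c)), gl_comm c]
        simp only [mul_assoc]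
        simp only [← mul_assoc _ _ (ι (ι d))]
        rw [← mul_assoc (gl z (m + 1)), key]
        simp only [mul_assoc]
      rw [this, E_sandwich, E_sandwich, mul_assoc, ← mul_assoc (gl z m) (gl z m), g_sq]
      simp only [add_mul, mul_add, smul_mul_assoc, mul_smul_comm, smul_add, smul_smul, one_mul,
        map_smul, map_mul, mul_assoc, mul_comm z]
  exact LinearMap.congr_fun this b

/-- The normalised Ocneanu trace. -/
noncomputable def tr : ∀ m : ℕ, Hecke z m →ₗ[K] K
  | 0 => (lift (A := K) (fun i => i.elim0) (fun i => i.elim0) (fun i => i.elim0)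
      (fun i => i.elim0)).toLinearMap
  | m + 1 => tr m ∘ₗ E z m v δ

theorem tr_zero_one : tr v δ 0 (1 : Hecke z 0) = 1 := by simp [tr]

theorem tr_succ (x : Hecke z (m + 1)) : tr v δ (m + 1) x = tr v δ m (E z m v δ x) := rfl

theorem tr_comm (x y : Hecke z m) : tr v δ m (x * y) = tr v δ m (y * x) := by
  induction m with
  | zero =>
    obtain ⟨c, rfl⟩ := zero_scalar x
    rw [Algebra.commutes]
  | succ m ih =>
    have hg : ∀ x, tr v δ (m + 1) (x * gl z m) = tr v δ (m + 1) (gl z m * x) := by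
      intro x
      have : tr v δ (m + 1) ∘ₗ LinearMap.mulRight K (gl z m) =
          tr v δ (m + 1) ∘ₗ LinearMap.mulLeft K (gl z m) := by
        refine ext_sandwich (fun a => ?_) (fun a b => ?_)
        · simp only [LinearMap.comp_apply, LinearMap.mulRight_apply, LinearMap.mulLeft_apply,
            tr_succ]
          rw [E_mul_ι, E_ι_mul, E_gl, Algebra.commutes]
        · simp only [LinearMap.comp_apply, LinearMap.mulRight_apply, LinearMap.mulLeft_apply,
            tr_succ]
          cases m with
          | zero =>
            obtain ⟨c, rfl⟩ := zero_scalar a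
            obtain ⟨d, rfl⟩ := zero_scalar b
            simp only [AlgHom.commutes, ← Algebra.smul_def, ← Algebra.commutes, mul_smul_comm,
              smul_mul_assoc]
          | succ m =>
            rw [mul_assoc, mul_assoc, ← mul_assoc (gl z _) (ι b), E_ι_mul, E_conj, ← mul_assoc,
              ← mul_assoc, E_mul_ι, E_conj]
            rw [mul_add, add_mul, map_add, map_add, mul_smul_comm, smul_mul_assoc]
            congr 1
            rw [tr_succ, tr_succ, E_mul_ι, E_ι_mul]
      exact LinearMap.congr_fun this x
    induction y using induction generalizing x with
    | one => simp
    | add b c hb hc => simp only [mul_add, add_mul, map_add, hb, hc]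
    | smul c b hb => simp only [mul_smul_comm, smul_mul_assoc, map_smul, hb]
    | mul y i hy =>
      rw [← mul_assoc]
      have hi : ∀ x, tr v δ (m + 1) (x * g z i) = tr v δ (m + 1) (g z i * x) := by
        cases i using Fin.lastCases with
        | cast i =>
          intro x
          rw [← ι_g, tr_succ, tr_succ, E_mul_ι, E_ι_mul, ih]
        | last => exact hg
      rw [hi, ← mul_assoc, hy, mul_assoc]

theorem ι_π (b : ArtinGroup m) : ι (π z b) = π z (ArtinGroup.ι b) := by
  induction b using ArtinGroup.induction with
  | one => simp
  | mul x i h =>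
    rw [map_mul, map_mul (ι (z := z)), h, map_mul, map_mul, ArtinGroup.ι_σ]
    congr 1
    exact ι_g i
  | inv x i h =>
    rw [map_mul, map_mul (ι (z := z)), h, map_mul, map_mul, π_inv, map_inv, ArtinGroup.ι_σ,
      π_inv, map_sub, AlgHom.commutes, ι_g]

section uniqueness

/-- Functions on the braid group that satisfy the skein relation. -/
def skeinFun (z : K) (m : ℕ) : Submodule K (ArtinGroup m → K) where
  carrier := {f | ∀ x i y, f (x * σ i * y) = f (x * (σ i)⁻¹ * y) + z * f (x * y)}
  add_mem' {f h} hf hh := fun x i y => by simp only [Pi.add_apply, hf x i y, hh x i y]; ring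
  zero_mem' := fun x i y => by simp
  smul_mem' c f hf := fun x i y => by simp only [Pi.smul_apply, smul_eq_mul, hf x i y]; ring

/-- The action of a braid on such functions by right translation. -/
def translate (z : K) {m : ℕ} (b : ArtinGroup m) : Module.End K (skeinFun z m) where
  toFun f := ⟨fun x => f.1 (x * b), fun x i y => by
    simpa only [mul_assoc] using f.2 x i (y * b)⟩
  map_add' _ _ := rfl
  map_smul' _ _ := rfl

theorem translate_mul (a b : ArtinGroup m) :
    translate z (a * b) = translate z a * translate z b :=
  LinearMap.ext fun f => Subtype.ext <| funext fun x =>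
    congrArg f.1 (mul_assoc x a b).symm

/-- The translations extend to the Hecke algebra. -/
noncomputable def skeinAct (z : K) (m : ℕ) : Hecke z m →ₐ[K] Module.End K (skeinFun z m) :=
  lift (fun i => translate z (σ i))
    (fun i => LinearMap.ext fun f => Subtype.ext <| funext fun x => by
      have := f.2 x i (σ i)
      rw [inv_mul_cancel_right] at this
      exact this.trans (add_comm _ _))
    (fun i j h => by simp only [← translate_mul, braid i j h])
    (fun i j h => by simp only [← translate_mul, comm i j h])

theorem skeinAct_π (b : ArtinGroup m) : skeinAct z m (π z b) = translate z b := by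
  induction b using ArtinGroup.induction with
  | one =>
    rw [map_one, map_one]
    exact LinearMap.ext fun f => Subtype.ext <| funext fun x => congrArg f.1 (mul_one x).symm
  | mul x i h =>
    rw [map_mul, map_mul, h, translate_mul]
    congr 1
    exact lift_g ..
  | inv x i h =>
    rw [map_mul, map_mul, h, translate_mul, π_inv, map_sub, AlgHom.commutes]
    congr 1
    rw [skeinAct, lift_g]
    refine LinearMap.ext fun f => Subtype.ext <| funext fun x => ?_
    have := f.2 x i 1
    simp only [mul_one] at this
    exact sub_eq_of_eq_add this

/-- A Markov trace is determined by its defining properties. -/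
theorem eq_tr (hδ : z * δ = ↑v⁻¹ - ↑v) (hz : IsUnit z) (f : ∀ m, ArtinGroup m → K)
    (hs : ∀ m, f m ∈ skeinFun z m) (hconj : ∀ m a b, f m (a * b) = f m (b * a))
    (h0 : f 0 1 = 1)
    (hpos : ∀ m b, f (m + 1) (ArtinGroup.ι b * σ (Fin.last m)) = ↑v⁻¹ * f m b)
    (hneg : ∀ m b, f (m + 1) (ArtinGroup.ι b * (σ (Fin.last m))⁻¹) = ↑v * f m b)
    (m : ℕ) (b : ArtinGroup m) : f m b = tr v δ m (π z b) := by
  let Q : ∀ m, Hecke z m →ₗ[K] K := fun m =>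
    { toFun := fun x => (skeinAct z m x ⟨f m, hs m⟩).1 1
      map_add' := fun x y => by simp
      map_smul' := fun c x => by simp }
  have hQ : ∀ m b, Q m (π z b) = f m b := fun m b => by
    show (skeinAct z m (π z b) ⟨f m, hs m⟩).1 1 = _
    rw [skeinAct_π]
    exact congrArg (f m) (one_mul b)
  have hι : ∀ m b, f (m + 1) (ArtinGroup.ι b) = δ * f m b := fun m b => by
    have := hs (m + 1) (ArtinGroup.ι b) (Fin.last m) 1
    simp only [mul_one, hpos, hneg] at this
    refine hz.mul_left_cancel ?_
    rw [← mul_assoc, hδ, sub_mul, this]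
    ring
  suffices H : ∀ m, Q m = tr v δ m by rw [← hQ, H]
  intro m
  induction m with
  | zero =>
    refine LinearMap.ext fun x => ?_
    obtain ⟨c, rfl⟩ := zero_scalar x
    rw [Algebra.algebraMap_eq_smul_one, map_smul, map_smul, tr_zero_one, ← map_one (π z), hQ, h0]
  | succ m ih =>
    refine ext_sandwich (fun a => ?_) (fun a b => ?_)
    · rw [tr_succ, E_ι, map_smul, ← ih]
      have : Q (m + 1) ∘ₗ ι.toLinearMap = δ • Q m := by
        refine LinearMap.ext_on span_π ?_
        rintro _ ⟨b, rfl⟩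
        rw [LinearMap.comp_apply, AlgHom.toLinearMap_apply, ι_π, hQ, hι, LinearMap.smul_apply, hQ,
          smul_eq_mul]
      exact LinearMap.congr_fun this a
    · rw [tr_succ, E_sandwich, map_smul, ← ih]
      have ha : a ∈ Submodule.span K (Set.range (π (m := m) z)) := by rw [span_π]; trivial
      have hb : b ∈ Submodule.span K (Set.range (π (m := m) z)) := by rw [span_π]; trivial
      induction ha using Submodule.span_induction with
      | mem a ha =>
        obtain ⟨a, rfl⟩ := ha
        induction hb using Submodule.span_induction with
        | mem b hb =>
          obtain ⟨b, rfl⟩ := hb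
          rw [ι_π, ι_π, gl, g, ← map_mul, ← map_mul, ← map_mul, hQ, hQ, hconj, ← mul_assoc,
            ← map_mul, hpos, hconj, smul_eq_mul]
        | zero => simp
        | add x y _ _ hx hy => simp only [map_add, mul_add, hx, hy, smul_eq_mul]
        | smul c x _ hx => simp only [map_smul, mul_smul_comm, hx, smul_eq_mul]; ring
      | zero => simp
      | add x y _ _ hx hy => simp only [map_add, mul_add, add_mul, hx, hy, smul_eq_mul]
      | smul c x _ hx =>
        simp only [map_smul, mul_smul_comm, smul_mul_assoc, hx, smul_eq_mul]; ring

end uniqueness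

theorem tr_pos (b : Hecke z m) :
    tr v δ (m + 1) (ι b * gl z m) = ↑v⁻¹ * tr v δ m b := by
  rw [tr_succ, E_ι_mul, E_gl, ← Algebra.commutes, ← Algebra.smul_def, map_smul, smul_eq_mul]

theorem tr_neg (hδ : z * δ = ↑v⁻¹ - ↑v) (b : Hecke z m) :
    tr v δ (m + 1) (ι b * π z (σ (Fin.last m))⁻¹) = ↑v * tr v δ m b := by
  rw [π_inv, mul_sub, map_sub, tr_pos, ← Algebra.commutes, ← Algebra.smul_def, map_smul, tr_succ,
    E_ι, map_smul, smul_eq_mul, smul_eq_mul, ← mul_assoc, hδ]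
  ring

end Hecke
end Hecke

/-! ## The HOMFLYPT polynomial -/

noncomputable section

open LaurentVZ ArtinGroup

namespace LaurentVZ
open LaurentPolynomial

/-- `v`, as a unit. -/
def vUnit : LaurentVZˣ := tUnit _

/-- The inverse of `z`. -/
def zInv : LaurentVZ := C (T (-1))

theorem z_mul_zInv : z * zInv = 1 := by
  rw [z, zInv, ← map_mul, ← T_add, add_neg_cancel, T_zero, map_one]

/-- The value of the HOMFLYPT polynomial on the trivial link with two components. -/
def δ : LaurentVZ := zInv * (↑vUnit⁻¹ - ↑vUnit)

theorem z_mul_δ : z * δ = ↑vUnit⁻¹ - ↑vUnit := by rw [δ, ← mul_assoc, z_mul_zInv, one_mul]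
end LaurentVZ

theorem expSum_σ {m : ℕ} (i : Fin m) : expSum (σ i) = .ofAdd 1 := lift_σ ..

theorem expSum_ι {m : ℕ} (b : ArtinGroup m) : expSum (ι b) = expSum b := by
  induction b using ArtinGroup.induction with
  | one => simp
  | mul x i h => simp only [map_mul, h, ι_σ, expSum_σ]
  | inv x i h => simp only [map_mul, map_inv, h, ι_σ, expSum_σ]

/-- `v ^ w(β)` as a character. -/
def vPow {m : ℕ} : ArtinGroup m →* LaurentVZˣ := (zpowersHom _ vUnit).comp expSum

theorem vPow_σ {m : ℕ} (i : Fin m) : vPow (σ i) = vUnit := by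
  simp [vPow, expSum_σ]

theorem vPow_ι {m : ℕ} (b : ArtinGroup m) : vPow (ι b) = vPow b := by
  simp [vPow, expSum_ι]

/-- The HOMFLYPT polynomial exists and is unique. -/
theorem existsUnique_isHomflypt : ∃! P : OrientedLink → LaurentVZ, IsHomflypt P := by
  let P : OrientedLink → LaurentVZ := Quot.lift
    (fun b => ↑(vPow b.2) * Hecke.tr vUnit δ b.1 (Hecke.π z b.2)) (by
      rintro _ _ (⟨α, β⟩ | ⟨β⟩ | ⟨β⟩)
      · simp only [map_mul, Hecke.tr_comm _ _ (Hecke.π z α), mul_comm (vPow α)]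
      · simp only [map_mul, ← Hecke.ι_π, vPow_σ, vPow_ι]
        have := Hecke.tr_pos (z := z) vUnit δ (Hecke.π z β)
        rw [Hecke.gl, Hecke.g] at this
        rw [this]
        simp [mul_assoc]
      · simp only [map_mul, ← Hecke.ι_π, map_inv vPow, vPow_σ, vPow_ι]
        rw [Hecke.tr_neg _ _ z_mul_δ]
        simp [mul_assoc])
  have hP : ∀ m (b : ArtinGroup m), P b.closure =
    ↑(vPow b) * Hecke.tr vUnit δ m (Hecke.π z b) := fun _ _ => rfl
  refine ⟨P, ⟨?_, ?_⟩, ?_⟩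
  · rw [hP]; simp [Hecke.tr_zero_one]
  · intro m α β i
    have hv : v = (vUnit : LaurentVZ) := rfl
    have : Hecke.π z (σ i) = Hecke.π z (σ i)⁻¹ + algebraMap _ _ z := by
      rw [Hecke.π_inv]; simp [Hecke.g]
    simp only [hP, map_mul, map_inv vPow, vPow_σ, this, mul_add, add_mul, map_add]
    rw [← Algebra.commutes, mul_assoc (algebraMap _ _ z), ← Algebra.smul_def, map_smul, hv]
    have h : (vUnit : LaurentVZ) ^ 2 * ↑vUnit⁻¹ = ↑vUnit := by rw [sq]; simp [mul_assoc]
    simp only [Units.val_mul, smul_eq_mul]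
    linear_combination (-(↑(vPow α) * ↑(vPow β)) *
      Hecke.tr vUnit δ m (Hecke.π z α * Hecke.π z (σ i)⁻¹ * Hecke.π z β)) * h
  · intro P' h
    refine funext fun L => ?_
    obtain ⟨⟨m, b⟩, rfl⟩ := Quot.exists_rep L
    show P' b.closure = P b.closure
    have key := Hecke.eq_tr vUnit δ z_mul_δ (IsUnit.of_mul_eq_one _ z_mul_zInv)
      (fun m b => (vPow b⁻¹).val * P' b.closure) ?_ ?_ ?_ ?_ ?_ m b
    · rw [hP, ← key]; simp
    · intro m x i y
      have hv : v = (vUnit : LaurentVZ) := rfl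
      have h' : (↑vUnit⁻¹ : LaurentVZ) * ↑vUnit = 1 := by simp
      simp only [h.skein, mul_inv_rev, map_mul, inv_inv, map_inv vPow (σ i), vPow_σ, hv, Units.val_mul]
      linear_combination ((vPow x⁻¹).val * (vPow y⁻¹).val * (z * P' (x * y).closure +
        vUnit * P' (x * (σ i)⁻¹ * y).closure)) * h'
    · intro m a b
      rw [closure_conj, mul_inv_rev, mul_inv_rev,
        map_mul, map_mul, mul_comm (vPow a⁻¹)]
    · simp [h.unknot]
    · intro m b
      rw [closure_stabPos, mul_inv_rev, map_mul, ← map_inv ι, vPow_ι,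
        map_inv vPow (σ _), vPow_σ]
      simp [mul_assoc]
    · intro m b
      rw [closure_stabNeg, mul_inv_rev, map_mul, ← map_inv ι, vPow_ι,
        inv_inv, vPow_σ]
      simp [mul_assoc]

/-- The HOMFLYPT polynomial: the unique invariant that satisfies `IsHomflypt`. -/
def homflypt : OrientedLink → LaurentVZ := Classical.choose existsUnique_isHomflypt.exists

theorem isHomflypt_homflypt : IsHomflypt homflypt :=
  Classical.choose_spec existsUnique_isHomflypt.exists

namespace LaurentVZ
/-- The substitution of `a` for `v` and `b` for `z`, where `a` and `b` are units. -/
def subst {A : Type} [CommRing A] (a b : Aˣ) : LaurentVZ →+* A :=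
  LaurentPolynomial.eval₂ (LaurentPolynomial.eval₂ (Int.castRingHom A) b) a
end LaurentVZ

theorem subst_v {A : Type} [CommRing A] (a b : Aˣ) : subst a b v = a := by
  simp [subst, v]
theorem subst_z {A : Type} [CommRing A] (a b : Aˣ) : subst a b z = b := by
  simp [subst, z]

/-- The Conway polynomial `∇(z) = P(1, z)`. -/
def conway (L : OrientedLink) : LaurentPolynomial ℤ :=
  subst 1 (tUnit ℤ) (homflypt L)

/-- `√t`: the variable of the field in which the Jones and Alexander polynomials are computed. -/
def sqrtT : (RatFunc ℚ)ˣ := Units.mk0 RatFunc.X RatFunc.X_ne_zero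

/-- `(t - 1) / √t`, where `t = (√t) ^ 2`. -/
def zOfT : (RatFunc ℚ)ˣ := Units.mk0 ((RatFunc.X ^ 2 - 1) / RatFunc.X) (by
  refine div_ne_zero ?_ RatFunc.X_ne_zero
  have : (RatFunc.X ^ 2 - 1 : RatFunc ℚ) = algebraMap (Polynomial ℚ) _ (.X ^ 2 - 1) := by simp
  rw [this]
  exact RatFunc.algebraMap_ne_zero (Polynomial.X_pow_sub_C_ne_zero (by norm_num) 1))

/-- The Jones polynomial `V(t) = P(t, (t - 1) / √t)`. -/
def jones (L : OrientedLink) : RatFunc ℚ := subst (sqrtT ^ 2) zOfT (homflypt L)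

/-- The Alexander polynomial `Δ(t) = P(1, (t - 1) / √t)`. -/
def alexander (L : OrientedLink) : RatFunc ℚ := subst 1 zOfT (homflypt L)
end

/-! ## Braid words -/

/-- Words in the generators of the braid group on `n` strands (where `1 ≤ n`) and their inverses:
the letter `(i, true)` is `σ i` and `(i, false)` is its inverse. -/
abbrev BraidWord (n : ℕ) : Type := List (Fin (n - 1) × Bool)

namespace BraidWord

/-- The writhe, or exponent sum, of a braid word. -/
def writhe {n : ℕ} (β : BraidWord n) : ℤ := (β.map fun p => if p.2 then 1 else -1).sum

/-- The braid on `n` strands that a word represents. -/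
def toBraid {n : ℕ} (β : BraidWord n) : ArtinGroup (n - 1) :=
  (β.map fun p => if p.2 then ArtinGroup.σ p.1 else (ArtinGroup.σ p.1)⁻¹).prod

/-- The link that is the closure of a braid word. -/
def closure {n : ℕ} (β : BraidWord n) : OrientedLink := β.toBraid.closure

end BraidWord

/-! On closed 3-braids of equal writhe, the HOMFLYPT polynomials can differ only by a multiple of
one fixed factor: $P_{\widehat\beta}-P_{\widehat\gamma}=v^{w}\,c(z)\,(1-\delta^2)$, where $w$ is the
common writhe, $\delta=(v^{-1}-v)/z$ is the value on the two-component unlink, and $c$ does not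
involve $v$ (`exists_homflypt_sub_eq`). A specialisation that is injective on Laurent polynomials in
$z$ and does not kill $1-\delta^2$ therefore detects whether $c=0$ (`homflypt_eq_of_subst_eq`). For
Conway and Alexander, $v=1$ forces $\delta=0$; for Jones, $\delta=-(\sqrt t+1/\sqrt t)$, whose
square is not 1.

The formula comes from the Ocneanu trace on the Hecke algebra of three strands. A braid is a
combination of six products of generators with coefficients in $\mathbb Z[z^{\pm1}]$
(`exists_coeff_of_three_strands`). The trace sees these six coefficients only through three
combinations. Sending both generators to a root $\omega$ of $X^2=zX+1$ maps the braid to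
$\omega^{w}$ (`χ_π`), so equal writhe gives two linear relations between the coefficients of the two
braids. One degree of freedom remains, and its contribution to the trace is $1-\delta^2$
(`Hecke.exists_tr_sub_eq`). -/

namespace Hecke
-- The Hecke algebra on three strands
open ArtinGroup LaurentPolynomial

/-- The span of the six products is stable under right multiplication by the generators, by the
quadratic and braid relations. These relations involve `z` but not `v`, so the coefficients can be
kept in the image of `C`; this is what later makes the factor `c` independent of `v`. -/
theorem exists_coeff_of_three_strands (b : ArtinGroup 2) :
    ∃ c₀ c₁ c₂ c₃ c₄ c₅ : LaurentPolynomial ℤ,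
      π LaurentVZ.z b = C c₀ • (1 : Hecke LaurentVZ.z 2) + C c₁ • g _ 0 + C c₂ • g _ 1 +
        C c₃ • (g _ 0 * g _ 1) + C c₄ • (g _ 1 * g _ 0) + C c₅ • (g _ 0 * g _ 1 * g _ 0) := by
  have h0 := g_sq (z := LaurentVZ.z) (0 : Fin 2)
  have h1 := g_sq (z := LaurentVZ.z) (1 : Fin 2)
  have hb := g_braid (z := LaurentVZ.z) (0 : Fin 2) 1 rfl
  have hz : LaurentVZ.z = C (T 1) := rfl
  have key : ∀ (i : Fin 2) (c₀ c₁ c₂ c₃ c₄ c₅ : LaurentPolynomial ℤ),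
      ∃ d₀ d₁ d₂ d₃ d₄ d₅ : LaurentPolynomial ℤ,
      (C c₀ • (1 : Hecke LaurentVZ.z 2) + C c₁ • g _ 0 + C c₂ • g _ 1 +
        C c₃ • (g _ 0 * g _ 1) + C c₄ • (g _ 1 * g _ 0) + C c₅ • (g _ 0 * g _ 1 * g _ 0)) * g _ i =
      C d₀ • (1 : Hecke LaurentVZ.z 2) + C d₁ • g _ 0 + C d₂ • g _ 1 +
        C d₃ • (g _ 0 * g _ 1) + C d₄ • (g _ 1 * g _ 0) + C d₅ • (g _ 0 * g _ 1 * g _ 0) := by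
    intro i c₀ c₁ c₂ c₃ c₄ c₅
    fin_cases i
    -- Here `T 1` is `z`. Multiplication by `g 0` pairs the six products as (1, `g 0`), (`g 1`, `g 1
    -- * g 0`), (`g 0 * g 1`, `g 0 * g 1 * g 0`); on each pair it acts by the quadratic relation.
    · refine ⟨c₁, c₀ + T 1 * c₁, c₄, c₅, c₂ + T 1 * c₄, c₃ + T 1 * c₅, ?_⟩
      simp only [Fin.zero_eta, add_mul, smul_mul_assoc, one_mul, mul_assoc _ (g _ 0) (g _ 0), h0,
        mul_add, mul_smul_comm, mul_one, map_add, map_mul, ← hz]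
      module
    · refine ⟨c₂, c₃, c₀ + T 1 * c₂, c₁ + T 1 * c₃, c₅, c₄ + T 1 * c₅, ?_⟩
      -- The braid relation on the last three factors produces a square of `g 0` in front.
      have h5 : g LaurentVZ.z (0 : Fin 2) * g _ 1 * g _ 0 * g _ 1 =
          LaurentVZ.z • (g _ 0 * g _ 1 * g _ 0) + g _ 1 * g _ 0 := by
        rw [mul_assoc, mul_assoc, ← mul_assoc (g _ 1), ← hb, ← mul_assoc, ← mul_assoc, h0]
        simp only [add_mul, smul_mul_assoc, one_mul]
      simp only [Fin.mk_one, add_mul, smul_mul_assoc, one_mul, h5, ← hb,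
        mul_assoc _ (g _ 1) (g _ 1), h1, mul_add, mul_smul_comm, mul_one, map_add, map_mul, ← hz]
      module
  induction b using ArtinGroup.induction with
  | one => exact ⟨1, 0, 0, 0, 0, 0, by simp only [map_one, map_zero]; module⟩
  | mul x i h =>
    obtain ⟨c₀, c₁, c₂, c₃, c₄, c₅, h⟩ := h
    rw [map_mul, h]
    exact key i ..
  | inv x i h =>
    obtain ⟨c₀, c₁, c₂, c₃, c₄, c₅, h⟩ := h
    obtain ⟨d₀, d₁, d₂, d₃, d₄, d₅, h'⟩ := key i c₀ c₁ c₂ c₃ c₄ c₅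
    -- The inverse of a generator is the generator minus `z`, so `z` times the old coefficients is
    -- subtracted.
    refine ⟨d₀ - T 1 * c₀, d₁ - T 1 * c₁, d₂ - T 1 * c₂, d₃ - T 1 * c₃, d₄ - T 1 * c₄,
      d₅ - T 1 * c₅, ?_⟩
    rw [map_mul, π_inv, mul_sub, ← Algebra.commutes, ← Algebra.smul_def, h, h']
    simp only [map_sub, map_mul, ← hz]
    module

/-! ### The character that records the exponent sum -/

section
variable {K : Type} [CommRing K]

/-- The character of the Hecke algebra that sends every generator to a root of `X² = z X + 1`. -/
noncomputable def χ (z : K) (m : ℕ) : Hecke z m →ₐ[K] QuadraticAlgebra K 1 z :=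
  lift (fun _ => QuadraticAlgebra.omega)
    (fun _ => by rw [QuadraticAlgebra.omega_mul_omega_eq_add]; simp [add_comm])
    (fun _ _ _ => rfl) (fun _ _ _ => rfl)

theorem χ_g (z : K) {m : ℕ} (i : Fin m) : χ z m (g z i) = QuadraticAlgebra.omega := lift_g ..

/-- The image of a generator under `χ`, as a unit. -/
def omegaUnit (z : K) : (QuadraticAlgebra K 1 z)ˣ where
  val := QuadraticAlgebra.omega
  inv := QuadraticAlgebra.omega - algebraMap K _ z
  val_inv := by ext <;> simp [QuadraticAlgebra.algebraMap_eq, QuadraticAlgebra.re_one, QuadraticAlgebra.im_one]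
  inv_val := by ext <;> simp [QuadraticAlgebra.algebraMap_eq, QuadraticAlgebra.re_one, QuadraticAlgebra.im_one]

/-- This is how the writhe constrains the coefficients. Adjoining the root formally, instead of
choosing one in `K`, makes each equality of values split into two equations over `K`, one for each
coordinate. -/
theorem χ_π (z : K) {m : ℕ} (b : ArtinGroup m) :
    χ z m (π z b) = ↑(zpowersHom _ (omegaUnit z) (expSum b)) := by
  induction b using ArtinGroup.induction with
  | one => simp
  | mul x i h =>
    simp only [map_mul, h, expSum_σ, Units.val_mul]
    congr 1
    rw [zpowersHom_apply, toAdd_ofAdd, zpow_one]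
    exact χ_g z i
  | inv x i h =>
    simp only [map_mul, h, map_inv, expSum_σ, Units.val_mul, π_inv, map_sub, χ_g]
    congr 1
    simp [omegaUnit]

/-! ### The Ocneanu trace on the six products -/

variable {z : K} (v : Kˣ) (δ : K)

theorem tr_ι (m : ℕ) (x : Hecke z m) : tr v δ (m + 1) (ι x) = δ * tr v δ m x := by
  rw [tr_succ, E_ι, map_smul, smul_eq_mul]

theorem tr_one_strand_one : tr v δ 1 (1 : Hecke z 1) = δ := by
  simpa [tr_zero_one] using tr_ι v δ 0 (1 : Hecke z 0)

theorem tr_one_strand_g : tr v δ 1 (g z 0) = ↑v⁻¹ := by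
  have := tr_pos v δ (1 : Hecke z 0)
  rwa [map_one, one_mul, tr_zero_one, mul_one] at this

theorem tr_two_one : tr v δ 2 (1 : Hecke z 2) = δ * δ := by
  simpa [tr_one_strand_one] using tr_ι v δ 1 (1 : Hecke z 1)

theorem tr_two_g_zero : tr v δ 2 (g z 0) = δ * ↑v⁻¹ := by
  have := tr_ι v δ 1 (g z 0)
  rwa [ι_g, tr_one_strand_g] at this

theorem tr_two_g_one : tr v δ 2 (g z 1) = ↑v⁻¹ * δ := by
  have := tr_pos v δ (1 : Hecke z 1)
  rwa [map_one, one_mul, tr_one_strand_one] at this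

theorem tr_two_g_mul_g : tr v δ 2 (g z 0 * g z 1) = ↑v⁻¹ * ↑v⁻¹ := by
  have := tr_pos v δ (g z (0 : Fin 1))
  rwa [ι_g, tr_one_strand_g] at this

/-- The trace property brings the two factors `g 0` together, and the quadratic relation reduces
their square. -/
theorem tr_two_longest :
    tr v δ 2 (g z 0 * g z 1 * g z 0) = z * (↑v⁻¹ * ↑v⁻¹) + ↑v⁻¹ * δ := by
  rw [tr_comm, ← mul_assoc, g_sq, add_mul, one_mul, smul_mul_assoc, map_add, map_smul,
    tr_two_g_mul_g, tr_two_g_one, smul_eq_mul]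
end

/-! ### Comparing two braids of equal exponent sum -/

theorem exists_tr_sub_eq (b b' : ArtinGroup 2) (h : expSum b = expSum b') :
    ∃ c : LaurentPolynomial ℤ, tr LaurentVZ.vUnit LaurentVZ.δ 2 (π LaurentVZ.z b) -
      tr LaurentVZ.vUnit LaurentVZ.δ 2 (π LaurentVZ.z b') =
        C c * (1 - LaurentVZ.δ ^ 2) := by
  obtain ⟨c₀, c₁, c₂, c₃, c₄, c₅, hc⟩ := exists_coeff_of_three_strands b
  obtain ⟨d₀, d₁, d₂, d₃, d₄, d₅, hd⟩ := exists_coeff_of_three_strands b'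
  have hχ : χ LaurentVZ.z 2 (π _ b) = χ LaurentVZ.z 2 (π _ b') := by rw [χ_π, χ_π, h]
  rw [hc, hd] at hχ ⊢
  -- The witness is the difference of the coefficients of $v^{-2}$ when the trace is written in
  -- terms of $\delta$ and $v^{-1}$.
  refine ⟨c₃ + c₄ + T 1 * c₅ - (d₃ + d₄ + T 1 * d₅), ?_⟩
  have hz : LaurentVZ.z = C (T 1) := rfl
  simp only [map_add, map_smul, map_mul, map_one, χ_g, QuadraticAlgebra.ext_iff] at hχ
  simp only [QuadraticAlgebra.re_add, QuadraticAlgebra.im_add, QuadraticAlgebra.re_smul,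
    QuadraticAlgebra.im_smul, QuadraticAlgebra.re_mul, QuadraticAlgebra.im_mul,
    QuadraticAlgebra.omega_re, QuadraticAlgebra.omega_im, QuadraticAlgebra.re_one,
    QuadraticAlgebra.im_one, smul_eq_mul] at hχ
  obtain ⟨h₁, h₂⟩ := hχ
  simp only [map_add, map_smul, smul_eq_mul, tr_two_one, tr_two_g_zero, tr_two_g_one,
    tr_two_g_mul_g, tr_two_longest, tr_comm _ _ (g _ 1) (g _ 0), map_sub, map_mul, ← hz]
  have hv : (↑LaurentVZ.vUnit⁻¹ * ↑LaurentVZ.vUnit : LaurentVZ) = 1 := by simp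
  have hδ := LaurentVZ.z_mul_δ
  generalize (↑LaurentVZ.vUnit⁻¹ : LaurentVZ) = w at *
  -- With $w=v^{-1}$ and $e$ the witness, `h₁` eliminates the coefficients of 1 and `h₂` those of `g
  -- 0` and `g 1`, leaving $e(w^2-wz\delta-\delta^2)$. Since $z\delta=w-v$ and $wv=1$, this is
  -- $e(1-\delta^2)$.
  linear_combination LaurentVZ.δ ^ 2 * h₁ + w * LaurentVZ.δ * h₂ +
    (C c₃ + C c₄ + LaurentVZ.z * C c₅ - (C d₃ + C d₄ + LaurentVZ.z * C d₅)) * (hv - w * hδ)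

end Hecke

/-! ### From the trace to the HOMFLYPT polynomial -/

noncomputable section
open LaurentVZ ArtinGroup

/-- After division by $v^{w}$, the skein relation becomes $\sigma_i=\sigma_i^{-1}+z$ and the two
stabilisations multiply by $v^{-1}$ and $v$. The rescaled invariant is thus a Markov trace, and
`Hecke.eq_tr` identifies it. -/
theorem homflypt_closure {m : ℕ} (b : ArtinGroup m) :
    homflypt b.closure = ↑(vPow b) * Hecke.tr vUnit δ m (Hecke.π z b) := by
  have h := isHomflypt_homflypt
  have key := Hecke.eq_tr vUnit δ z_mul_δ (IsUnit.of_mul_eq_one _ z_mul_zInv)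
    (fun m b => (vPow b⁻¹).val * homflypt b.closure) ?_ ?_ ?_ ?_ ?_ m b
  · rw [← key]; simp
  · intro m x i y
    have hv : v = (vUnit : LaurentVZ) := rfl
    have h' : (↑vUnit⁻¹ : LaurentVZ) * ↑vUnit = 1 := by simp
    simp only [h.skein, mul_inv_rev, map_mul, inv_inv, map_inv vPow (σ i), vPow_σ, hv,
      Units.val_mul]
    linear_combination ((vPow x⁻¹).val * (vPow y⁻¹).val * (z * homflypt (x * y).closure +
      vUnit * homflypt (x * (σ i)⁻¹ * y).closure)) * h'
  · intro m a b
    rw [closure_conj, mul_inv_rev, mul_inv_rev, map_mul, map_mul, mul_comm (vPow a⁻¹)]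
  · simp [h.unknot]
  · intro m b
    rw [closure_stabPos, mul_inv_rev, map_mul, ← map_inv ι, vPow_ι, map_inv vPow (σ _), vPow_σ]
    simp [mul_assoc]
  · intro m b
    rw [closure_stabNeg, mul_inv_rev, map_mul, ← map_inv ι, vPow_ι, inv_inv, vPow_σ]
    simp [mul_assoc]

/-- Equal writhe enters twice: through the trace difference, and because it gives both polynomials
the same unit factor. -/
theorem exists_homflypt_sub_eq (b b' : ArtinGroup 2) (h : expSum b = expSum b') :
    ∃ c : LaurentPolynomial ℤ, homflypt b.closure - homflypt b'.closure =
      ↑(vPow b) * (LaurentPolynomial.C c * (1 - δ ^ 2)) := by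
  obtain ⟨c, hc⟩ := Hecke.exists_tr_sub_eq b b' h
  refine ⟨c, ?_⟩
  have : vPow b' = vPow b := by simp [vPow, h]
  rw [homflypt_closure, homflypt_closure, this, ← mul_sub, hc]

/-! ### Specialisations of the HOMFLYPT polynomial -/

theorem subst_C {A : Type} [CommRing A] (a b : Aˣ) (c : LaurentPolynomial ℤ) :
    subst a b (LaurentPolynomial.C c) = LaurentPolynomial.eval₂ (Int.castRingHom A) b c := by
  simp [subst]

/-- As `b` is a unit, this determines the specialised `δ`; the form without division holds in any
commutative ring. -/
theorem subst_z_mul_subst_δ {A : Type} [CommRing A] (a b : Aˣ) :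
    ↑b * subst a b δ = ↑a⁻¹ - ↑a := by
  have h : Units.map (subst a b).toMonoidHom vUnit = a := Units.ext (subst_v a b)
  have h' : subst a b ↑vUnit⁻¹ = ↑a⁻¹ := by
    conv_rhs => rw [← h]
    rfl
  rw [← subst_z a b, ← map_mul, z_mul_δ, map_sub, h']
  exact congrArg _ (subst_v a b)

/-- A specialisation of the HOMFLYPT polynomial that is faithful in `z` and does not annihilate
`1 - δ²` determines it on closed 3-braids of given writhe. -/
theorem homflypt_eq_of_subst_eq {A : Type} [CommRing A] [IsDomain A] (a b : Aˣ)
    (hb : Function.Injective (LaurentPolynomial.eval₂ (Int.castRingHom A) b))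
    (hδ : (1 - subst a b δ ^ 2) ≠ 0) (x y : ArtinGroup 2) (hw : expSum x = expSum y)
    (h : subst a b (homflypt x.closure) = subst a b (homflypt y.closure)) :
    homflypt x.closure = homflypt y.closure := by
  obtain ⟨c, hc⟩ := exists_homflypt_sub_eq x y hw
  have h' := congrArg (subst a b) hc
  rw [map_sub, h, sub_self, map_mul, map_mul, map_sub, map_pow, map_one, subst_C] at h'
  -- The power of `v` stays a unit after substitution and cancels.
  have h0 := (((vPow x).isUnit.map (subst a b)).mul_right_eq_zero.1 h'.symm)
  have hc0 : c = 0 := hb (by rw [(mul_eq_zero.1 h0).resolve_right hδ, map_zero])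
  rw [← sub_eq_zero, hc, hc0]
  simp

/-! ### Faithfulness in z, and nonvanishing of 1 - δ² -/

theorem eval₂_tUnit (c : LaurentPolynomial ℤ) :
    LaurentPolynomial.eval₂ (Int.castRingHom _) (tUnit ℤ) c = c := by
  induction c using LaurentPolynomial.induction_on' with
  | add p q hp hq => rw [map_add, hp, hq]
  | C_mul_T n a =>
    rw [LaurentPolynomial.eval₂_C_mul_T]
    have : ∀ n : ℤ, (tUnit ℤ ^ n).val = LaurentPolynomial.T n := fun n => by
      induction n with
      | zero => simp
      | succ n ih =>
        rw [zpow_add_one, Units.val_mul, ih, LaurentPolynomial.T_add]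
        rfl
      | pred n ih =>
        rw [zpow_sub_one, Units.val_mul, ih, LaurentPolynomial.T_sub]
        rfl
    rw [this]
    simp

theorem transcendental_zOfT : Transcendental ℚ (zOfT : RatFunc ℚ) := by
  suffices h : ¬∃ c, (zOfT : RatFunc ℚ) = RatFunc.C c by
    convert RatFunc.transcendental_of_ne_C _ h
    · rfl
    -- Two instances of the `ℚ`-algebra structure occur; a ring carries at most one such structure.
    · exact Subsingleton.elim (α := Algebra ℚ (RatFunc ℚ)) _ _
  rintro ⟨c, hc⟩
  -- If $(X^2-1)/X$ were a constant $c$, then $X$ would be a root of this polynomial, which is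
  -- nonzero since its value at 0 is $-1$.
  refine RatFunc.transcendental_X (K := ℚ) ⟨.X ^ 2 - .C c * .X - 1, ?_, ?_⟩
  · intro h
    have := congrArg (Polynomial.eval 0) h
    norm_num at this
  · have hX := RatFunc.X_ne_zero (K := ℚ)
    simp only [zOfT, Units.val_mk0] at hc
    rw [div_eq_iff hX] at hc
    simp only [map_sub, map_pow, map_mul, map_one, Polynomial.aeval_X, Polynomial.aeval_C]
    rw [RatFunc.algebraMap_eq_C]
    linear_combination hc

/-- Multiplication by a power of the variable turns a Laurent polynomial in the kernel into an
ordinary one that vanishes at a transcendental element. -/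
theorem eval₂_zOfT_injective :
    Function.Injective (LaurentPolynomial.eval₂ (Int.castRingHom (RatFunc ℚ)) zOfT) := by
  rw [injective_iff_map_eq_zero]
  intro c hc
  obtain ⟨n, p, hp⟩ := c.exists_T_pow
  have h := congrArg (LaurentPolynomial.eval₂ (Int.castRingHom (RatFunc ℚ)) zOfT) hp
  rw [map_mul, hc, zero_mul, LaurentPolynomial.eval₂_toLaurent] at h
  have hp0 : p = 0 := by
    have h1 := (transcendental_iff.1 transcendental_zOfT) (p.map (Int.castRingHom ℚ)) (by
      rw [Polynomial.aeval_def, Polynomial.eval₂_map, ← h]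
      congr 1
      exact RingHom.ext_int _ _)
    exact (Polynomial.map_eq_zero_iff (RingHom.injective_int _)).1 h1
  rw [hp0, map_zero] at hp
  exact ((LaurentPolynomial.isUnit_T n).mul_left_eq_zero.1 hp.symm)

theorem one_sub_subst_δ_sq_ne_zero_of_v_eq_one {A : Type} [CommRing A] [Nontrivial A] (b : Aˣ) :
    1 - subst 1 b δ ^ 2 ≠ 0 := by
  have h := subst_z_mul_subst_δ 1 b
  rw [inv_one, sub_self, Units.mul_right_eq_zero] at h
  simp [h]

/-- With $X=\sqrt t$, clearing denominators gives $X(X^2-1)\delta=1-X^4$, so $\delta^2=1$ would be a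
nontrivial algebraic equation for $X$. -/
theorem one_sub_subst_δ_sq_ne_zero_of_jones : 1 - subst (sqrtT ^ 2) zOfT δ ^ 2 ≠ 0 := by
  have h := subst_z_mul_subst_δ (sqrtT ^ 2) zOfT
  have hX := RatFunc.X_ne_zero (K := ℚ)
  intro h0
  generalize subst (sqrtT ^ 2) zOfT δ = d at *
  simp only [zOfT, sqrtT, Units.val_mk0, Units.val_pow_eq_pow_val, Units.val_inv_eq_inv_val] at h
  field_simp at h
  refine RatFunc.transcendental_X (K := ℚ)
    ⟨.X ^ 2 * (.X ^ 2 - 1) ^ 2 - (1 - .X ^ 4) ^ 2, fun hp => ?_, ?_⟩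
  · have := congrArg (Polynomial.eval 2) hp
    norm_num at this
  · simp only [map_sub, map_pow, map_mul, map_one, Polynomial.aeval_X]
    linear_combination (RatFunc.X * (RatFunc.X ^ 2 - 1) * d + (1 - RatFunc.X ^ 4)) * h +
      RatFunc.X ^ 2 * (RatFunc.X ^ 2 - 1) ^ 2 * h0

/-! ### Braid words and the theorem -/

theorem expSum_toBraid {n : ℕ} (β : BraidWord n) : expSum β.toBraid = .ofAdd β.writhe := by
  induction β with
  | nil => simp [BraidWord.toBraid, BraidWord.writhe]
  | cons p β ih =>
    simp only [BraidWord.toBraid, BraidWord.writhe, List.map_cons, List.prod_cons, List.sum_cons,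
      map_mul, ofAdd_add] at ih ⊢
    rw [ih]
    congr 1
    split_ifs <;> simp [expSum_σ]

end

theorem mainTheorem8 (β γ : BraidWord 3) (hw : β.writhe = γ.writhe)
    (h : conway β.closure = conway γ.closure ∨ jones β.closure = jones γ.closure ∨
      alexander β.closure = alexander γ.closure) :
    homflypt β.closure = homflypt γ.closure := by
  have hw' : ArtinGroup.expSum β.toBraid = ArtinGroup.expSum γ.toBraid := by
    rw [expSum_toBraid, expSum_toBraid, hw]
  rcases h with h | h | h
  -- For Conway, the substitution in `z` is the identity, so its injectivity is immediate.
  · refine homflypt_eq_of_subst_eq 1 (tUnit ℤ) (fun c d hcd => ?_)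
      (one_sub_subst_δ_sq_ne_zero_of_v_eq_one _) β.toBraid γ.toBraid hw' h
    rwa [eval₂_tUnit, eval₂_tUnit] at hcd
  · exact homflypt_eq_of_subst_eq _ _ eval₂_zOfT_injective one_sub_subst_δ_sq_ne_zero_of_jones
      β.toBraid γ.toBraid hw' h
  · exact homflypt_eq_of_subst_eq _ _ eval₂_zOfT_injective
      (one_sub_subst_δ_sq_ne_zero_of_v_eq_one _) β.toBraid γ.toBraid hw' h
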